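/- **Theorem (Detection delay lower bound).** Let $G=(V,E)$ be a finite graph with a set of monitors $M\subseteq V$, and let $\mathcal P$ be a finite set of probes, i.e. of walks in $G$ with both endpoints in $M$. For $e\in E$ let $\mathcal P_e$ be the set of probes in $\mathcal P$ that traverse $e$. Each probe $P\in\mathcal P$ has a pre-change distribution $f_{0,P}$ and, for each $e\in E$, a post-change distribution $f_{1,P}^{(e)}$ (probability distributions on a common measurable space), with $f_{1,P}^{(e)}=f_{0,P}$ whenever $P\notin\mathcal P_e$. At most one edge is faulty. If the edge $e^*$ becomes faulty at time $\nu\in\{1,2,\dots\}$, then the observations $X_{P,t}$ ($P\in\mathcal P$, $t=0,1,2,\dots$) are all independent, with $X_{P,t}\sim f_{0,P}$ for $t<\nu$ and $X_{P,t}\sim f_{1,P}^{(e^*)}$ for $t\ge\nu$; write $\mathbb P_\nu^{(e^*)},\mathbb E_\nu^{(e^*)}$ for their law and expectation. If no edge is faulty ($\nu=\infty$), all observations are independent with $X_{P,t}\sim f_{0,P}$, with expectation $\mathbb E_\infty$. A rule $(\tau,\lambda)$ consists of a stopping time $\tau$, with values in $\{0,1,2,\dots\}\cup\{\infty\}$,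 of the filtration $\mathcal F_t=\sigma(X_{P,s}: P\in\mathcal P,\ s\le t)$, and an $\mathcal F_\tau$-measurable $E$-valued $\lambda$ (the declared edge). Its worst-case average detection delay is $$\mathrm{WADD}(\tau)=\sup_{\nu\ge1}\mathbb E_\nu^{(e^*)}[\tau-\nu\mid\tau\ge\nu]\in[0,\infty],$$ where those $\nu$ with $\mathbb P_\nu^{(e^*)}[\tau\ge\nu]=0$ contribute $0$. Let $\mathcal C_\gamma$ be the set of rules $(\tau_\gamma,\lambda_\gamma)$ that are the member at level $\gamma$ of a family $(\tau_{\gamma'},\lambda_{\gamma'})_{\gamma'\in\mathbb R}$ of rules such that $\mathbb E_\infty[\tau_{\gamma'}]\ge\gamma'$ for all $\gamma'$ and the localization is asymptotically accurate: for every finite $\nu\ge1$, $\mathbb P_\nu^{(e^*)}[\nu\le\tau_{\gamma'}<\infty,\ \lambda_{\gamma'}\ne e^*]\to0$ as $\gamma'\to\infty$. Let $e^*\in E$ be the faulty edge, and assume that $f_{1,P}^{(e^*)}\ne f_{0,P}$ for at least one $P\in\mathcal P_{e^*}$. Then, as $\gamma\to\infty$, $$\inf_{(\tau,\lambda)\in\mathcal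 C_\gamma}\mathrm{WADD}(\tau)\ \ge\ \frac{\log\gamma}{\sum_{P\in\mathcal P_{e^*}}D\big(f_{1,P}^{(e^*)}\,\big\|\,f_{0,P}\big)}\,(1+o(1)),$$ where $D$ is the Kullback–Leibler divergence (with values in $[0,\infty]$; the bound reads $0$ if the sum is $\infty$), and the $o(1)$ is a function of $\gamma$ alone, uniform over $\mathcal C_\gamma$. -/

import Mathlib

open MeasureTheory ProbabilityTheory Filter Topology
open scoped ENNReal

namespace FaultLocalization

/-- A probe in a network `G` with monitor set `M`: a walk of `G` (edges and vertices may be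
repeated) whose two endpoints are monitors. -/
structure Probe {V : Type*} (G : SimpleGraph V) (M : Set V) where
  source : V
  target : V
  source_mem : source ∈ M
  target_mem : target ∈ M
  walk : G.Walk source target

/-- The probe `P` passes through the edge `e`. -/
def Probe.Traverses {V : Type*} {G : SimpleGraph V} {M : Set V} (P : Probe G M)
    (e : G.edgeSet) : Prop :=
  (e : Sym2 V) ∈ P.walk.edges

open scoped Classical in
/-- The set of the probes of `Q` that pass through the edge `e`. -/
noncomputable def probesThrough {V : Type*} {G : SimpleGraph V} {M : Set V}
    (Q : Finset (Probe G M)) (e : G.edgeSet) : Finset Q :=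
  Finset.univ.filter fun P => P.1.Traverses e

section Observations

variable {ι : Type*} {𝒳 : ι → Type*} [∀ i, MeasurableSpace (𝒳 i)]

/-- Sample paths `(X_t)_{t ≥ 0}`, where `X_t = (X_{i,t})_i` collects the observations of all the
probes at time `t`. -/
abbrev Path (𝒳 : ι → Type*) : Type _ := ℕ → ∀ i, 𝒳 i

/-- The law of the observations when the change happens at time `ν`: all observations are
independent (over time and over the probes), `X_{i,t}` has law `f₀ i` for `t < ν` and law `f₁ i`
for `t ≥ ν`. For `ν = ⊤` there is no change, and this is the law under which all the `X_t` have
law `∏ i, f₀ i`. -/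
noncomputable def pathLaw [Fintype ι] (f₀ f₁ : ∀ i, Measure (𝒳 i)) (ν : ℕ∞) :
    Measure (Path 𝒳) :=
  Measure.infinitePi fun t : ℕ => if (t : ℕ∞) < ν then Measure.pi f₀ else Measure.pi f₁

/-- The filtration generated by the observations, `ℱ_t = σ(X_0, …, X_t)`. -/
def obsFiltration (𝒳 : ι → Type*) [∀ i, MeasurableSpace (𝒳 i)] :
    Filtration ℕ (MeasurableSpace.pi : MeasurableSpace (Path 𝒳)) :=
  Filtration.piLE (X := fun _ : ℕ => ∀ i, 𝒳 i)

/-- A detection and localization rule: a (possibly infinite) stopping time `τ` of the observations,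
and an edge `loc`, declared at time `τ` on the basis of the observations up to time `τ`. -/
structure Rule (𝒳 : ι → Type*) [∀ i, MeasurableSpace (𝒳 i)] (E : Type*) where
  τ : Path 𝒳 → ℕ∞
  isStoppingTime : IsStoppingTime (obsFiltration 𝒳) τ
  loc : Path 𝒳 → E
  measurable_loc : ∀ e : E, MeasurableSet[isStoppingTime.measurableSpace] {ω | loc ω = e}

variable [Fintype ι] {E : Type*}

/-- The average run length to false alarm `𝔼_∞[τ]`. -/
noncomputable def Rule.runLength (ρ : Rule 𝒳 E) (f₀ f₁ : ∀ i, Measure (𝒳 i)) : ℝ≥0∞ :=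
  ∫⁻ ω, (ρ.τ ω : ℝ≥0∞) ∂pathLaw f₀ f₁ ⊤

/-- The worst-case average detection delay `sup_{ν ≥ 1} 𝔼_ν[τ - ν | τ ≥ ν]`. Change points `ν` at
which `τ ≥ ν` has probability zero contribute `0`. -/
noncomputable def Rule.wadd (ρ : Rule 𝒳 E) (f₀ f₁ : ∀ i, Measure (𝒳 i)) : ℝ≥0∞ :=
  ⨆ (ν : ℕ) (_ : 1 ≤ ν),
    ∫⁻ ω, ((ρ.τ ω - (ν : ℕ∞) : ℕ∞) : ℝ≥0∞) ∂(pathLaw f₀ f₁ ν)[|{ω | (ν : ℕ∞) ≤ ρ.τ ω}]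

/-- Families of rules `(τ_γ, λ_γ)_γ` that meet the false alarm requirement `𝔼_∞[τ_γ] ≥ γ` and whose
localization is asymptotically accurate when `e` is the faulty edge: for every finite change point
`ν`, the probability that a wrong edge is declared at or after time `ν` tends to `0` as `γ → ∞`. -/
def admissibleFamilies (f₀ f₁ : ∀ i, Measure (𝒳 i)) (e : E) : Set (ℝ → Rule 𝒳 E) :=
  {s | (∀ γ : ℝ, ENNReal.ofReal γ ≤ (s γ).runLength f₀ f₁) ∧
    ∀ ν : ℕ, 1 ≤ ν → Tendsto
      (fun γ => pathLaw f₀ f₁ ν {ω | (ν : ℕ∞) ≤ (s γ).τ ω ∧ (s γ).τ ω < ⊤ ∧ (s γ).loc ω ≠ e})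
      atTop (𝓝 0)}

/-- The class `𝒞_γ`: the members at level `γ` of the admissible families. -/
def ruleClass (f₀ f₁ : ∀ i, Measure (𝒳 i)) (e : E) (γ : ℝ) : Set (Rule 𝒳 E) :=
  (fun s => s γ) '' admissibleFamilies f₀ f₁ e

end Observations

end FaultLocalization

/-! Stopping soon after a change means collecting enough evidence to tell it apart from no change,
and evidence accrues at mean rate `D`, the sum of the divergences, per time step. Let `E_∞ τ ≥ γ`
and let `w` bound the worst-case delay.

Averaging over the starting point gives a window of length `m` which, without a change, contains `τ`
with conditional probability below `1/c`, given that `τ` is not earlier; this needs only `m < E_∞ τ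
/ c` (`exists_window_lt`). Put the change at the start of that window. Then `τ ≥ ν` has the same
probability under both laws, and by Markov's inequality `τ` lies in the window with conditional
probability at least `1 - w/m`.

Let `S` be the log-likelihood ratio collected from the change until `τ` or the end of the window. By
Wald's identity its conditional mean is at most `(w + 1) D`. Since `E[exp (-S)]` on an event is at
most the no-change probability of that event, the convexity bound `1 + log c ≤ S + c exp (-S)` turns
the rarity of the window into a lower bound for this mean (`IsLogLikelihood.window_inequality`). The
outcome is `(1 - w/m) log c ≤ (w + 1) D + 1` (`IsLogLikelihood.delay_bound`).

With `L = log γ`, `m ≈ L²` and `c = γ / (4 L²)`, one has `log c ~ L`, while `w/m → 0` unless `w ≥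
L/D` already. The resulting error depends on `D` and `γ` alone. -/

namespace FaultLocalization

/-! ### Densities and independence for infinite product measures. -/

section ProductMeasures

variable {κ : Type*} {Y : κ → Type*} [∀ i, MeasurableSpace (Y i)]

/-- Changing finitely many factors of a product measure by densities `g i` amounts to the density
`∏ i ∈ s, g i (ω i)`. -/
lemma infinitePi_eq_withDensity_prod {μ ν : ∀ i, Measure (Y i)}
    [∀ i, IsProbabilityMeasure (μ i)] [∀ i, IsProbabilityMeasure (ν i)]
    (s : Finset κ) {g : ∀ i, Y i → ℝ≥0∞} (hg : ∀ i, Measurable (g i))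
    (hs : ∀ i ∈ s, ν i = (μ i).withDensity (g i)) (hs' : ∀ i ∉ s, ν i = μ i) :
    Measure.infinitePi ν =
      (Measure.infinitePi μ).withDensity (fun ω => ∏ i ∈ s, g i (ω i)) := by
  classical
  symm
  refine Measure.eq_infinitePi _ fun u t ht => ?_
  let T : ∀ i, Set (Y i) := fun i => if i ∈ u then t i else Set.univ
  let G : ∀ i, Y i → ℝ≥0∞ := fun i => if i ∈ s then g i else 1
  have hT : ∀ i, MeasurableSet (T i) := fun i => by
    by_cases hi : i ∈ u <;> simp [T, hi, ht i]
  have hG : ∀ i, Measurable (G i) := fun i => by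
    by_cases hi : i ∈ s
    · simp [G, hi, hg i]
    · simp only [G, hi, if_false]; exact measurable_const
  have hν : ∀ i, ν i = (μ i).withDensity (G i) := fun i => by
    by_cases hi : i ∈ s
    · simp [G, hi, hs i hi]
    · simp [G, hi, hs' i hi]
  have hbox : MeasurableSet ((u : Set κ).pi t) := .pi u.countable_toSet fun i _ => ht i
  -- The density cut off to a box is again a product of functions of single coordinates, so by
  -- independence its integral factors.
  have key : ∀ ω : ∀ i, Y i, ((u : Set κ).pi t).indicator (fun ω => ∏ i ∈ s, g i (ω i)) ω
      = ∏ i ∈ s ∪ u, (T i).indicator (G i) (ω i) := fun ω => by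
    by_cases hω : ω ∈ (u : Set κ).pi t
    · rw [Set.indicator_of_mem hω]
      have h1 : ∀ i ∈ s ∪ u, (T i).indicator (G i) (ω i) = G i (ω i) := fun i _ => by
        refine Set.indicator_of_mem ?_ _
        by_cases hi : i ∈ u
        · simpa [T, hi] using hω i hi
        · simp [T, hi]
      rw [Finset.prod_congr rfl h1]
      have h2 : ∏ i ∈ s, g i (ω i) = ∏ i ∈ s, G i (ω i) :=
        Finset.prod_congr rfl fun i hi => by simp [G, hi]
      rw [h2]
      refine Finset.prod_subset Finset.subset_union_left fun i _ hi => by simp [G, hi]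
    · rw [Set.indicator_of_notMem hω]
      simp only [Set.mem_pi, not_forall] at hω
      obtain ⟨i, hi, hω⟩ := hω
      symm
      refine Finset.prod_eq_zero (Finset.mem_union_right _ hi) ?_
      refine Set.indicator_of_notMem ?_ _
      simpa [T, Finset.mem_coe.1 hi] using hω
  have hindep := iIndepFun_infinitePi (P := μ) (X := fun i => (T i).indicator (G i))
    (fun i => (hG i).indicator (hT i))
  rw [withDensity_apply _ hbox, ← lintegral_indicator hbox, lintegral_congr key,
    lintegral_prod_eq_prod_lintegral_of_indepFun _ _ hindep
      (fun i => ((hG i).indicator (hT i)).comp (measurable_pi_apply i))]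
  have h3 : ∀ i, ∫⁻ ω, (T i).indicator (G i) (ω i) ∂Measure.infinitePi μ = ν i (T i) := fun i => by
    rw [(measurePreserving_eval_infinitePi μ i).lintegral_comp ((hG i).indicator (hT i)),
      lintegral_indicator (hT i), hν i, withDensity_apply _ (hT i)]
  simp_rw [h3]
  rw [← Finset.prod_subset (Finset.subset_union_right (s₁ := s) (s₂ := u))
    (f := fun i => ν i (T i)) (fun i _ hi => by simp [T, hi])]
  exact Finset.prod_congr rfl fun i hi => by simp [T, hi]

lemma infinitePi_apply_congr {μ ν : ∀ i, Measure (Y i)}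
    [∀ i, IsProbabilityMeasure (μ i)] [∀ i, IsProbabilityMeasure (ν i)] (s : Finset κ)
    (h : ∀ i ∈ s, μ i = ν i) {C : Set (∀ i, Y i)}
    (hC : MeasurableSet[MeasurableSpace.pi.comap (s.restrict (π := Y))] C) :
    Measure.infinitePi μ C = Measure.infinitePi ν C := by
  obtain ⟨S, hS, rfl⟩ := hC
  rw [← Measure.map_apply (Finset.measurable_restrict s) hS,
    ← Measure.map_apply (Finset.measurable_restrict s) hS,
    Measure.infinitePi_map_restrict, Measure.infinitePi_map_restrict]
  congr 2
  funext i
  exact h i i.2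

/-- An event that depends on the coordinates in `s` is independent of the coordinate `j ∉ s`. -/
lemma setIntegral_eval_infinitePi {μ : ∀ i, Measure (Y i)}
    [∀ i, IsProbabilityMeasure (μ i)] (s : Finset κ) {j : κ} (hj : j ∉ s) {C : Set (∀ i, Y i)}
    (hC : MeasurableSet[MeasurableSpace.pi.comap (s.restrict (π := Y))] C)
    {f : Y j → ℝ} (hf : Measurable f) :
    ∫ ω in C, f (ω j) ∂Measure.infinitePi μ
      = (Measure.infinitePi μ).real C * ∫ y, f y ∂μ j := by
  obtain ⟨S, hS, rfl⟩ := hC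
  have hSm : MeasurableSet (s.restrict (π := Y) ⁻¹' S) := Finset.measurable_restrict s hS
  have hind : IndepFun (fun (ω : ∀ i, Y i) (i : s) => ω i)
      (fun (ω : ∀ i, Y i) (i : ({j} : Finset κ)) => ω i) (Measure.infinitePi μ) :=
    (iIndepFun_infinitePi (P := μ) (X := fun i => id) (fun i => measurable_id)).indepFun_finset
      s {j}
      (by simpa using hj) (fun i => measurable_pi_apply i)
  have hφ : Measurable (S.indicator (fun _ => (1 : ℝ))) := measurable_const.indicator hS
  have hind' := hind.comp (φ := S.indicator (fun _ => (1 : ℝ)))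
    (ψ := fun x : (∀ i : ({j} : Finset κ), Y i) => f (x ⟨j, Finset.mem_singleton_self j⟩))
    hφ (by fun_prop)
  have h := hind'.integral_mul_eq_mul_integral
    (hφ.comp (by fun_prop)).aestronglyMeasurable
    (hf.comp (measurable_pi_apply j)).aestronglyMeasurable
  have h1 : ∫ ω, f (ω j) ∂Measure.infinitePi μ = ∫ y, f y ∂μ j := by
    rw [← Measure.infinitePi_map_eval μ j]
    exact (integral_map (measurable_pi_apply j).aemeasurable hf.aestronglyMeasurable).symm
  rw [← h1, ← integral_indicator hSm, ← integral_indicator_one hSm]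
  refine (integral_congr_ae (ae_of_all _ fun ω => ?_)).trans h
  by_cases hω : s.restrict ω ∈ S
  · have hω' : (fun i : s => ω i) ∈ S := hω
    simp [Set.indicator, hω, hω']
  · have hω' : (fun i : s => ω i) ∉ S := hω
    simp [Set.indicator, hω, hω']

end ProductMeasures

/-! ### Log-likelihood ratios with finite mean. -/

section LogLikelihood

/-- `d` is an everywhere finite density of `μ₁` with respect to `μ₀`, and `ℓ` is its logarithm
(with an arbitrary value where `d` vanishes), which has mean `D` under `μ₁`. -/
structure IsLogLikelihood {Y : Type*} [MeasurableSpace Y] (μ₀ μ₁ : Measure Y) (d : Y → ℝ≥0∞)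
    (ℓ : Y → ℝ) (D : ℝ) : Prop where
  measurable_density : Measurable d
  measurable_log : Measurable ℓ
  withDensity_eq : μ₁ = μ₀.withDensity d
  mul_exp_neg_le : ∀ y, d y * ENNReal.ofReal (Real.exp (-ℓ y)) ≤ 1
  integrable : Integrable ℓ μ₁
  integral_eq : ∫ y, ℓ y ∂μ₁ = D

/-- The Radon–Nikodym derivative is almost everywhere finite, so passing through `toReal` changes it
on a null set only. Where it vanishes, the product with `exp (-ℓ)` is `0`; elsewhere it is `1`. -/
lemma exists_isLogLikelihood {Y : Type*} [MeasurableSpace Y] (μ₀ μ₁ : Measure Y)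
    [IsProbabilityMeasure μ₀] [IsProbabilityMeasure μ₁]
    (h : InformationTheory.klDiv μ₁ μ₀ ≠ ∞) :
    ∃ d ℓ, IsLogLikelihood μ₀ μ₁ d ℓ (InformationTheory.klDiv μ₁ μ₀).toReal := by
  obtain ⟨hac, hintg⟩ := InformationTheory.klDiv_ne_top_iff.1 h
  refine ⟨fun y => ENNReal.ofReal (μ₁.rnDeriv μ₀ y).toReal, llr μ₁ μ₀, ?_, measurable_llr _ _,
    ?_, fun y => ?_, hintg, ?_⟩
  · exact (Measure.measurable_rnDeriv μ₁ μ₀).ennreal_toReal.ennreal_ofReal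
  · conv_lhs => rw [← Measure.withDensity_rnDeriv_eq μ₁ μ₀ hac]
    refine withDensity_congr_ae ?_
    filter_upwards [Measure.rnDeriv_lt_top μ₁ μ₀] with y hy
    rw [ENNReal.ofReal_toReal hy.ne]
  · rw [← ENNReal.ofReal_mul ENNReal.toReal_nonneg, ENNReal.ofReal_le_one]
    rcases (ENNReal.toReal_nonneg (a := μ₁.rnDeriv μ₀ y)).eq_or_lt with h0 | h0
    · rw [← h0, zero_mul]; exact zero_le_one
    · rw [llr_def, Real.exp_neg, Real.exp_log h0, mul_inv_cancel₀ h0.ne']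
  -- Equal total masses remove the correction term in `klDiv`.
  · exact (InformationTheory.toReal_klDiv_of_measure_eq hac (by simp)).symm

/-- Log-likelihoods of independent components add up. -/
lemma IsLogLikelihood.pi {ι : Type*} [Fintype ι] {𝒳 : ι → Type*} [∀ i, MeasurableSpace (𝒳 i)]
    {f₀ f₁ : ∀ i, Measure (𝒳 i)} [∀ i, IsProbabilityMeasure (f₀ i)]
    [∀ i, IsProbabilityMeasure (f₁ i)] {d : ∀ i, 𝒳 i → ℝ≥0∞} {ℓ : ∀ i, 𝒳 i → ℝ} {D : ι → ℝ}
    (h : ∀ i, IsLogLikelihood (f₀ i) (f₁ i) (d i) (ℓ i) (D i)) :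
    IsLogLikelihood (Measure.pi f₀) (Measure.pi f₁) (fun x => ∏ i, d i (x i))
      (fun x => ∑ i, ℓ i (x i)) (∑ i, D i) where
  measurable_density := Finset.measurable_prod _ fun i _ =>
    (h i).measurable_density.comp (measurable_pi_apply i)
  measurable_log := Finset.measurable_sum _ fun i _ =>
    (h i).measurable_log.comp (measurable_pi_apply i)
  withDensity_eq := by
    rw [← Measure.infinitePi_eq_pi, ← Measure.infinitePi_eq_pi]
    exact infinitePi_eq_withDensity_prod Finset.univ (fun i => (h i).measurable_density)
      (fun i _ => (h i).withDensity_eq) (fun i hi => absurd (Finset.mem_univ i) hi)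
  mul_exp_neg_le x := by
    rw [← Finset.sum_neg_distrib, Real.exp_sum,
      ENNReal.ofReal_prod_of_nonneg fun i _ => (Real.exp_pos _).le, ← Finset.prod_mul_distrib]
    exact Finset.prod_le_one' fun i _ => (h i).mul_exp_neg_le (x i)
  integrable := integrable_finsetSum _ fun i _ =>
    (measurePreserving_eval f₁ i).integrable_comp_of_integrable (h i).integrable
  integral_eq := by
    refine (integral_finsetSum _ fun i _ =>
      (measurePreserving_eval f₁ i).integrable_comp_of_integrable (h i).integrable).trans
      (Finset.sum_congr rfl fun i _ => ?_)
    rw [← (h i).integral_eq, ← (measurePreserving_eval f₁ i).map_eq]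
    exact (integral_map (measurable_pi_apply i).aemeasurable
      (h i).measurable_log.aestronglyMeasurable).symm

end LogLikelihood

/-! ### Change of measure for a change-point model. -/

section ChangePoint

variable {Y : Type*} [MeasurableSpace Y]

/-- The law of independent observations, distributed as `μ₀` before time `ν` and as `μ₁` from time
`ν` on. -/
noncomputable def changeLaw (μ₀ μ₁ : Measure Y) (ν : ℕ∞) : Measure (ℕ → Y) :=
  Measure.infinitePi fun t : ℕ => if (t : ℕ∞) < ν then μ₀ else μ₁

instance isProbabilityMeasure_ite {μ₀ μ₁ : Measure Y} [IsProbabilityMeasure μ₀]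
    [IsProbabilityMeasure μ₁] (p : Prop) [Decidable p] :
    IsProbabilityMeasure (if p then μ₀ else μ₁) := by
  split_ifs <;> infer_instance

variable {μ₀ μ₁ : Measure Y} [IsProbabilityMeasure μ₀] [IsProbabilityMeasure μ₁]

instance (ν : ℕ∞) : IsProbabilityMeasure (changeLaw μ₀ μ₁ ν) := by
  unfold changeLaw; infer_instance

/-- The observations strictly before the change do not depend on the change. -/
lemma changeLaw_apply_of_lt {n : ℕ} {ν ν' : ℕ∞} (hlt₁ : (n : ℕ∞) < ν) (hlt₂ : (n : ℕ∞) < ν')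
    {C : Set (ℕ → Y)} (hC : MeasurableSet[Filtration.piLE (X := fun _ : ℕ => Y) n] C) :
    changeLaw μ₀ μ₁ ν C = changeLaw μ₀ μ₁ ν' C := by
  rw [Filtration.piLE_eq_comap_frestrictLe] at hC
  refine infinitePi_apply_congr (Finset.Iic n) (fun i hi => ?_) hC
  have hi' : (i : ℕ∞) ≤ n := by exact_mod_cast Finset.mem_Iic.1 hi
  rw [if_pos (hi'.trans_lt hlt₁), if_pos (hi'.trans_lt hlt₂)]

/-- Change of measure from the law with change point `ν` to the law without a change. -/
lemma IsLogLikelihood.setLIntegral_exp_le {d : Y → ℝ≥0∞} {ℓ : Y → ℝ} {D : ℝ}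
    (h : IsLogLikelihood μ₀ μ₁ d ℓ D) (ν n : ℕ) {C : Set (ℕ → Y)}
    (hC : MeasurableSet[Filtration.piLE (X := fun _ : ℕ => Y) (ν + n)] C) :
    ∫⁻ ω in C, ENNReal.ofReal (Real.exp (-∑ k ∈ Finset.range (n + 1), ℓ (ω (ν + k))))
      ∂changeLaw μ₀ μ₁ ν ≤ changeLaw μ₀ μ₁ ⊤ C := by
  have hCm : MeasurableSet C := Filtration.le _ _ _ hC
  -- The laws with change at `ν` and with no change differ in infinitely many factors. Postponing
  -- the change to `ν + n + 1` alters only finitely many, and up to time `ν + n` the postponed law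
  -- agrees with the no-change law.
  have hden : changeLaw μ₀ μ₁ ν = (changeLaw μ₀ μ₁ ((ν + n + 1 : ℕ) : ℕ∞)).withDensity
      (fun ω => ∏ t ∈ Finset.Ico ν (ν + n + 1), d (ω t)) := by
    refine infinitePi_eq_withDensity_prod _ (fun _ => h.measurable_density) (fun t ht => ?_)
      (fun t ht => ?_)
    · rw [Finset.mem_Ico] at ht
      have h1 : ¬ (t : ℕ∞) < ν := by exact_mod_cast not_lt.2 ht.1
      have h2 : (t : ℕ∞) < ((ν + n + 1 : ℕ) : ℕ∞) := by exact_mod_cast ht.2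
      rw [if_neg h1, if_pos h2]
      exact h.withDensity_eq
    · rw [Finset.mem_Ico, not_and_or, not_le, not_lt] at ht
      rcases ht with ht | ht
      · have h1 : (t : ℕ∞) < ν := by exact_mod_cast ht
        have h2 : (t : ℕ∞) < ((ν + n + 1 : ℕ) : ℕ∞) := by exact_mod_cast (by omega : t < ν + n + 1)
        rw [if_pos h1, if_pos h2]
      · have h1 : ¬ (t : ℕ∞) < ν := by exact_mod_cast (by omega : ¬ t < ν)
        have h2 : ¬ (t : ℕ∞) < ((ν + n + 1 : ℕ) : ℕ∞) := by exact_mod_cast not_lt.2 ht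
        rw [if_neg h1, if_neg h2]
  have hd := h.measurable_density
  have hl := h.measurable_log
  have hlt : ((ν + n : ℕ) : ℕ∞) < ((ν + n + 1 : ℕ) : ℕ∞) := by
    exact_mod_cast Nat.lt_succ_self (ν + n)
  rw [← changeLaw_apply_of_lt hlt (ENat.natCast_lt_top _) hC, hden,
    setLIntegral_withDensity_eq_setLIntegral_mul _ (by fun_prop) (by fun_prop) hCm,
    ← setLIntegral_one]
  refine setLIntegral_mono measurable_const fun ω _ => ?_
  rw [Pi.mul_apply, Finset.prod_Ico_eq_prod_range, ← Finset.sum_neg_distrib, Real.exp_sum,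
    ENNReal.ofReal_prod_of_nonneg fun i _ => (Real.exp_pos _).le, add_assoc,
    Nat.add_sub_cancel_left, ← Finset.prod_mul_distrib]
  exact Finset.prod_le_one' fun i _ => h.mul_exp_neg_le _

/-- From the change point on, the present observation is independent of the past. -/
lemma IsLogLikelihood.setIntegral_eq {d : Y → ℝ≥0∞} {ℓ : Y → ℝ} {D : ℝ}
    (h : IsLogLikelihood μ₀ μ₁ d ℓ D) {ν n : ℕ} (hn : ν ≤ n + 1) {C : Set (ℕ → Y)}
    (hC : MeasurableSet[Filtration.piLE (X := fun _ : ℕ => Y) n] C) :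
    ∫ ω in C, ℓ (ω (n + 1)) ∂changeLaw μ₀ μ₁ ν = (changeLaw μ₀ μ₁ ν).real C * D := by
  rw [Filtration.piLE_eq_comap_frestrictLe] at hC
  have hn' : ¬ ((n + 1 : ℕ) : ℕ∞) < ν := by exact_mod_cast not_lt.2 hn
  refine (setIntegral_eval_infinitePi (Finset.Iic n) (j := n + 1) (by simp) hC
    h.measurable_log).trans ?_
  rw [if_neg hn', h.integral_eq]
  rfl

lemma IsLogLikelihood.integrable_eval {d : Y → ℝ≥0∞} {ℓ : Y → ℝ} {D : ℝ}
    (h : IsLogLikelihood μ₀ μ₁ d ℓ D) {ν t : ℕ} (ht : ν ≤ t) :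
    Integrable (fun ω => ℓ (ω t)) (changeLaw μ₀ μ₁ ν) := by
  have ht' : ¬ (t : ℕ∞) < ν := by exact_mod_cast not_lt.2 ht
  refine (measurePreserving_eval_infinitePi _ t).integrable_comp_of_integrable ?_
  rw [if_neg ht']
  exact h.integrable

end ChangePoint

/-! ### The information inequality for a stopping time. -/

section StoppingTimes

lemma integrableOn_and_setIntegral_le_of_setLIntegral_le {Ω : Type*} [MeasurableSpace Ω]
    {μ : Measure Ω} {A : Set Ω} {f : Ω → ℝ} (hf : Measurable f) (hf0 : ∀ ω, 0 ≤ f ω)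
    {M : ℝ≥0∞} (hM : M ≠ ∞) (h : ∫⁻ ω in A, ENNReal.ofReal (f ω) ∂μ ≤ M) :
    IntegrableOn f A μ ∧ ∫ ω in A, f ω ∂μ ≤ M.toReal := by
  refine ⟨⟨hf.aestronglyMeasurable, ?_⟩, ?_⟩
  · rw [hasFiniteIntegral_iff_ofReal (ae_of_all _ hf0)]
    exact h.trans_lt hM.lt_top
  · rw [integral_eq_lintegral_of_nonneg_ae (ae_of_all _ hf0) hf.aestronglyMeasurable]
    exact ENNReal.toReal_mono hM h

/-- The tangent line of `exp` at `0`, evaluated at `log c - x`. -/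
lemma one_add_log_le {c : ℝ} (hc : 0 < c) (x : ℝ) : 1 + Real.log c ≤ x + c * Real.exp (-x) := by
  have h := Real.add_one_le_exp (Real.log c - x)
  rw [sub_eq_add_neg, Real.exp_add, Real.exp_log hc] at h
  linarith

variable {Y : Type*} [MeasurableSpace Y] {τ : (ℕ → Y) → ℕ∞}

/-- As the complement of `τ ≤ n`, the event `τ ≥ n + 1` is already decided at time `n`. This
one-step lead makes it independent of the observation at time `n + 1`. -/
lemma measurableSet_succ_le (hτ : IsStoppingTime (Filtration.piLE (X := fun _ : ℕ => Y)) τ)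
    (n : ℕ) :
    MeasurableSet[Filtration.piLE (X := fun _ : ℕ => Y) n] {ω | ((n + 1 : ℕ) : ℕ∞) ≤ τ ω} := by
  convert (hτ n).compl using 1
  ext ω
  change ((n + 1 : ℕ) : ℕ∞) ≤ τ ω ↔ ¬ τ ω ≤ (n : ℕ∞)
  rw [not_le]
  push_cast
  exact ENat.add_one_le_iff (ENat.natCast_ne_top n)

lemma measurableSet_natCast_le (hτ : IsStoppingTime (Filtration.piLE (X := fun _ : ℕ => Y)) τ)
    (n : ℕ) : MeasurableSet {ω | (n : ℕ∞) ≤ τ ω} := by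
  cases n with
  | zero => simp
  | succ n => exact Filtration.le _ _ _ (measurableSet_succ_le hτ n)

variable {μ₀ μ₁ : Measure Y} [IsProbabilityMeasure μ₀] [IsProbabilityMeasure μ₁]

/-- An information inequality for the event that the stopping time `τ` falls into the window
`[a + 1, a + 1 + (b + 1))` that starts at the change point `a + 1`. -/
lemma IsLogLikelihood.window_inequality
    {d : Y → ℝ≥0∞} {ℓ : Y → ℝ} {D : ℝ}
    (h : IsLogLikelihood μ₀ μ₁ d ℓ D)
    (hτ : IsStoppingTime (Filtration.piLE (X := fun _ : ℕ => Y)) τ) (a b : ℕ) {c : ℝ}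
    (hc : 0 < c) :
    (1 + Real.log c) * (changeLaw μ₀ μ₁ ((a + 1 : ℕ) : ℕ∞)).real
          {ω | ((a + 1 : ℕ) : ℕ∞) ≤ τ ω ∧ τ ω < ((a + 1 + (b + 1) : ℕ) : ℕ∞)}
        + (changeLaw μ₀ μ₁ ((a + 1 : ℕ) : ℕ∞)).real {ω | ((a + 1 + (b + 1) : ℕ) : ℕ∞) ≤ τ ω}
      ≤ (∑ k ∈ Finset.range (b + 1),
          (changeLaw μ₀ μ₁ ((a + 1 : ℕ) : ℕ∞)).real {ω | ((a + 1 + k : ℕ) : ℕ∞) ≤ τ ω}) * D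
        + c * (changeLaw μ₀ μ₁ ⊤).real
          {ω | ((a + 1 : ℕ) : ℕ∞) ≤ τ ω ∧ τ ω < ((a + 1 + (b + 1) : ℕ) : ℕ∞)}
        + (changeLaw μ₀ μ₁ ⊤).real {ω | ((a + 1 + (b + 1) : ℕ) : ℕ∞) ≤ τ ω} := by
  set P := changeLaw μ₀ μ₁ ((a + 1 : ℕ) : ℕ∞) with hP
  set A := {ω | ((a + 1 : ℕ) : ℕ∞) ≤ τ ω ∧ τ ω < ((a + 1 + (b + 1) : ℕ) : ℕ∞)} with hA
  set B := {ω | ((a + 1 + (b + 1) : ℕ) : ℕ∞) ≤ τ ω} with hB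
  let T : ℕ → Set (ℕ → Y) := fun k => {ω | ((a + 1 + k : ℕ) : ℕ∞) ≤ τ ω}
  -- The log-likelihood ratio stopped at `τ` or at the end of the window. The `k`-th cutoff is
  -- decided at time `a + k`, before the observation it multiplies, whence Wald's identity `hSval`.
  let S : (ℕ → Y) → ℝ := fun ω =>
    ∑ k ∈ Finset.range (b + 1), (T k).indicator (fun ω => ℓ (ω (a + 1 + k))) ω
  have hT' : ∀ k, MeasurableSet[Filtration.piLE (X := fun _ : ℕ => Y) (a + k)] (T k) := fun k => by
    have := measurableSet_succ_le hτ (a + k)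
    rwa [show a + k + 1 = a + 1 + k by omega] at this
  have hT : ∀ k, MeasurableSet (T k) := fun k => Filtration.le _ _ _ (hT' k)
  have hBm : MeasurableSet B := hT (b + 1)
  have hAm : MeasurableSet A := by
    have : A = T 0 \ B := by ext ω; simp [A, T, B]
    rw [this]
    exact (hT 0).diff hBm
  have hℓ := h.measurable_log
  have hSm : Measurable S := Finset.measurable_sum _ fun k _ =>
    Measurable.indicator (by fun_prop) (hT k)
  have hintg : ∀ k, Integrable ((T k).indicator (fun ω => ℓ (ω (a + 1 + k)))) P := fun k =>
    (h.integrable_eval (by omega)).indicator (hT k)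
  have hSint : Integrable S P := integrable_finsetSum _ fun k _ => hintg k
  have hSval : ∫ ω, S ω ∂P = (∑ k ∈ Finset.range (b + 1), P.real (T k)) * D := by
    rw [Finset.sum_mul, integral_finsetSum _ fun k _ => hintg k]
    refine Finset.sum_congr rfl fun k _ => ?_
    rw [integral_indicator (hT k), show a + 1 + k = a + k + 1 by omega]
    exact h.setIntegral_eq (by omega) (hT' k)
  have hSeq : ∀ j ≤ b, ∀ ω, ((a + 1 + j : ℕ) : ℕ∞) ≤ τ ω →
      (j < b → τ ω < ((a + 1 + (j + 1) : ℕ) : ℕ∞)) →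
      S ω = ∑ k ∈ Finset.range (j + 1), ℓ (ω (a + 1 + k)) := fun j hj ω h1 h2 => by
    refine (Finset.sum_subset (Finset.range_mono (by omega : j + 1 ≤ b + 1)) ?_).symm.trans ?_
    rotate_left
    · refine Finset.sum_congr rfl fun k hk => Set.indicator_of_mem ?_ _
      have : ((a + 1 + k : ℕ) : ℕ∞) ≤ ((a + 1 + j : ℕ) : ℕ∞) := by
        have := Finset.mem_range.1 hk
        exact_mod_cast (by omega : a + 1 + k ≤ a + 1 + j)
      exact this.trans h1
    · intro k hk hk'
      rw [Finset.mem_range] at hk hk'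
      refine Set.indicator_of_notMem ?_ _
      have : ((a + 1 + (j + 1) : ℕ) : ℕ∞) ≤ ((a + 1 + k : ℕ) : ℕ∞) := by
        exact_mod_cast (by omega : a + 1 + (j + 1) ≤ a + 1 + k)
      exact not_le.2 ((h2 (by omega)).trans_le this)
  have hexpB : ∫⁻ ω in B, ENNReal.ofReal (Real.exp (-S ω)) ∂P ≤ changeLaw μ₀ μ₁ ⊤ B := by
    refine le_trans (le_of_eq ?_) (h.setLIntegral_exp_le (a + 1) b
      (C := B) ((show a + (b + 1) = a + 1 + b by omega) ▸ hT' (b + 1)))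
    refine setLIntegral_congr_fun hBm fun ω hω => ?_
    have hle : ((a + 1 + b : ℕ) : ℕ∞) ≤ ((a + 1 + (b + 1) : ℕ) : ℕ∞) := by
      exact_mod_cast (by omega : a + 1 + b ≤ a + 1 + (b + 1))
    simp only [hSeq b le_rfl ω (hle.trans hω) (fun hb => absurd hb (lt_irrefl b))]
  let C : ℕ → Set (ℕ → Y) := fun k => {ω | τ ω = ((a + 1 + k : ℕ) : ℕ∞)}
  have hC' : ∀ k, MeasurableSet[Filtration.piLE (X := fun _ : ℕ => Y) (a + 1 + k)] (C k) :=
    fun k => hτ.measurableSet_eq (a + 1 + k)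
  have hC : ∀ k, MeasurableSet (C k) := fun k => Filtration.le _ _ _ (hC' k)
  have hCdisj : Set.PairwiseDisjoint (Finset.range (b + 1) : Set ℕ) C := by
    intro i _ j _ hij
    refine Set.disjoint_left.2 fun ω hi hj => hij ?_
    have : ((a + 1 + i : ℕ) : ℕ∞) = ((a + 1 + j : ℕ) : ℕ∞) := hi.symm.trans hj
    have : a + 1 + i = a + 1 + j := by exact_mod_cast this
    omega
  -- On `A` the number of terms in `S` depends on `τ`, so the change of measure is applied
  -- separately for each value of `τ`.
  have hAC : A = ⋃ k ∈ Finset.range (b + 1), C k := by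
    ext ω
    simp only [A, C, Set.mem_ofPred_eq, Set.mem_iUnion, Finset.mem_range, exists_prop]
    constructor
    · rintro ⟨h1, h2⟩
      lift τ ω to ℕ using (h2.trans_le le_top).ne with t
      have h1' : a + 1 ≤ t := by exact_mod_cast h1
      have h2' : t < a + 1 + (b + 1) := by exact_mod_cast h2
      exact ⟨t - (a + 1), by omega, by exact_mod_cast (by omega : t = a + 1 + (t - (a + 1)))⟩
    · rintro ⟨k, hk, hω⟩
      rw [hω]
      exact ⟨by exact_mod_cast (by omega : a + 1 ≤ a + 1 + k),
        by exact_mod_cast (by omega : a + 1 + k < a + 1 + (b + 1))⟩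
  have hexpA : ∫⁻ ω in A, ENNReal.ofReal (Real.exp (-S ω)) ∂P ≤ changeLaw μ₀ μ₁ ⊤ A := by
    rw [hAC, lintegral_biUnion_finset hCdisj (fun k _ => hC k),
      measure_biUnion_finset hCdisj (fun k _ => hC k)]
    refine Finset.sum_le_sum fun k hk => ?_
    rw [Finset.mem_range] at hk
    refine le_trans (le_of_eq ?_) (h.setLIntegral_exp_le (a + 1) k (hC' k))
    refine setLIntegral_congr_fun (hC k) fun ω hω => ?_
    have hω' : τ ω = ((a + 1 + k : ℕ) : ℕ∞) := hω
    have hlt : ((a + 1 + k : ℕ) : ℕ∞) < ((a + 1 + (k + 1) : ℕ) : ℕ∞) := by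
      exact_mod_cast (by omega : a + 1 + k < a + 1 + (k + 1))
    simp only [hSeq k (by omega) ω hω'.ge (fun _ => hω' ▸ hlt)]
  have hem : Measurable fun ω => Real.exp (-S ω) := hSm.neg.exp
  obtain ⟨hiA, hvA⟩ := integrableOn_and_setIntegral_le_of_setLIntegral_le hem
    (fun ω => (Real.exp_pos _).le) (measure_ne_top _ A) hexpA
  obtain ⟨hiB, hvB⟩ := integrableOn_and_setIntegral_le_of_setLIntegral_le hem
    (fun ω => (Real.exp_pos _).le) (measure_ne_top _ B) hexpB
  -- The convexity bound is used with `c` on `A` and with constant `1` on `B`; when `τ` precedes the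
  -- change, `S = 0`.
  have hpt : ∀ ω, A.indicator (fun _ => 1 + Real.log c) ω + B.indicator (fun _ => (1 : ℝ)) ω
      ≤ S ω + c * A.indicator (fun ω => Real.exp (-S ω)) ω
        + B.indicator (fun ω => Real.exp (-S ω)) ω := fun ω => by
    by_cases hωB : ω ∈ B
    · have hωA : ω ∉ A := fun hω => not_lt.2 hωB hω.2
      simp only [hωA, hωB, Set.indicator_of_mem, Set.indicator_of_notMem, not_false_eq_true]
      have := one_add_log_le one_pos (S ω)
      simp only [Real.log_one, one_mul] at this
      linarith
    · by_cases hωA : ω ∈ A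
      · simp only [hωA, hωB, Set.indicator_of_mem, Set.indicator_of_notMem, not_false_eq_true]
        linarith [one_add_log_le hc (S ω)]
      · have hlt : τ ω < ((a + 1 : ℕ) : ℕ∞) := by
          by_contra hcon
          exact hωA ⟨not_lt.1 hcon, not_le.1 hωB⟩
        have hS0 : S ω = 0 := Finset.sum_eq_zero fun k _ => by
          have hle : ((a + 1 : ℕ) : ℕ∞) ≤ ((a + 1 + k : ℕ) : ℕ∞) := by
            exact_mod_cast (by omega : a + 1 ≤ a + 1 + k)
          have hω : ω ∉ T k := not_le.2 (hlt.trans_le hle)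
          exact Set.indicator_of_notMem hω _
        simp [hωA, hωB, hS0]
  have hmono := integral_mono (μ := P)
    (((integrable_const (1 + Real.log c)).indicator hAm).add
      ((integrable_const (1 : ℝ)).indicator hBm))
    ((hSint.add (((integrable_indicator_iff hAm).2 hiA).const_mul c)).add
      ((integrable_indicator_iff hBm).2 hiB)) hpt
  rw [integral_add' ((integrable_const (1 + Real.log c)).indicator hAm)
      ((integrable_const (1 : ℝ)).indicator hBm),
    integral_add' (hSint.add (((integrable_indicator_iff hAm).2 hiA).const_mul c))
      ((integrable_indicator_iff hBm).2 hiB),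
    integral_add' hSint (((integrable_indicator_iff hAm).2 hiA).const_mul c),
    integral_const_mul, integral_indicator hAm, integral_indicator hBm, integral_indicator hAm,
    integral_indicator hBm, hSval, setIntegral_const, setIntegral_const] at hmono
  simp only [smul_eq_mul, mul_one] at hmono
  have hvA' : ∫ ω in A, Real.exp (-S ω) ∂P ≤ (changeLaw μ₀ μ₁ ⊤).real A := hvA
  have hvB' : ∫ ω in B, Real.exp (-S ω) ∂P ≤ (changeLaw μ₀ μ₁ ⊤).real B := hvB
  have := mul_le_mul_of_nonneg_left hvA' hc.le
  have hsum : ∑ k ∈ Finset.range (b + 1), P.real (T k)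
    = ∑ k ∈ Finset.range (b + 1), P.real {ω | ((a + 1 + k : ℕ) : ℕ∞) ≤ τ ω} := rfl
  rw [← hsum]
  linarith

end StoppingTimes

/-! ### From run length to delay. -/

section DelayBound

lemma enat_toENNReal_eq_tsum (n : ℕ∞) :
    (n : ℝ≥0∞) = ∑' a : ℕ, if ((a + 1 : ℕ) : ℕ∞) ≤ n then 1 else 0 := by
  cases n with
  | top => simp
  | coe n =>
    rw [tsum_eq_sum (s := Finset.range n)]
    · rw [Finset.sum_congr rfl (g := fun _ => (1 : ℝ≥0∞))]
      · simp
      · intro a ha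
        rw [if_pos]
        exact_mod_cast Finset.mem_range.1 ha
    · intro a ha
      rw [if_neg]
      rw [Finset.mem_range] at ha
      exact_mod_cast ha

/-- A finite time lies in at most `m` of the windows of length `m`, and the time `⊤` in none. -/
lemma tsum_window_le (n : ℕ∞) (m : ℕ) :
    (∑' a : ℕ, if ((a + 1 : ℕ) : ℕ∞) ≤ n ∧ n < ((a + 1 + m : ℕ) : ℕ∞) then (1 : ℝ≥0∞) else 0)
      ≤ m := by
  cases n with
  | top => simp
  | coe n =>
    rw [tsum_eq_sum (s := Finset.Ico (n - m) n)]
    · refine (Finset.sum_le_card_nsmul _ _ 1 fun a _ => ?_).trans ?_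
      · split_ifs <;> simp
      · rw [Nat.card_Ico, nsmul_one]
        exact_mod_cast (by omega : n - (n - m) ≤ m)
    · intro a ha
      rw [if_neg]
      rintro ⟨h1, h2⟩
      have h1' : a + 1 ≤ n := by exact_mod_cast h1
      have h2' : n < a + 1 + m := by exact_mod_cast h2
      exact ha (Finset.mem_Ico.2 ⟨by omega, by omega⟩)

/-- A random time with a large mean has a window in which it is unlikely to fall, given that it
does not fall before the window. -/
lemma exists_window_lt {Ω : Type*} [MeasurableSpace Ω] (P : Measure Ω) [IsProbabilityMeasure P]
    {τ : Ω → ℕ∞} (hτ : ∀ n : ℕ, MeasurableSet {ω | (n : ℕ∞) ≤ τ ω}) (m : ℕ) {q : ℝ≥0∞}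
    (h : (m : ℝ≥0∞) < q * ∫⁻ ω, (τ ω : ℝ≥0∞) ∂P) :
    ∃ a : ℕ, P {ω | ((a + 1 : ℕ) : ℕ∞) ≤ τ ω ∧ τ ω < ((a + 1 + m : ℕ) : ℕ∞)}
      < q * P {ω | ((a + 1 : ℕ) : ℕ∞) ≤ τ ω} := by
  classical
  by_contra! hcon
  refine absurd h (not_lt.2 ?_)
  have hw : ∀ a : ℕ,
      MeasurableSet {ω | ((a + 1 : ℕ) : ℕ∞) ≤ τ ω ∧ τ ω < ((a + 1 + m : ℕ) : ℕ∞)} := fun a => by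
    have : {ω | ((a + 1 : ℕ) : ℕ∞) ≤ τ ω ∧ τ ω < ((a + 1 + m : ℕ) : ℕ∞)}
        = {ω | ((a + 1 : ℕ) : ℕ∞) ≤ τ ω} \ {ω | ((a + 1 + m : ℕ) : ℕ∞) ≤ τ ω} := by
      ext ω; simp
    rw [this]
    exact (hτ _).diff (hτ _)
  have hsum : ∀ s : ℕ → Set Ω, (∀ a, MeasurableSet (s a)) →
      ∑' a, P (s a) = ∫⁻ ω, ∑' a, (s a).indicator (1 : Ω → ℝ≥0∞) ω ∂P := fun s hs => by
    rw [lintegral_tsum fun a => (measurable_one.indicator (hs a)).aemeasurable]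
    exact tsum_congr fun a => (lintegral_indicator_one (hs a)).symm
  -- If every window were likely, summing over its starting point would contradict `h`: the tails
  -- sum to the mean, the windows to at most `m`.
  calc q * ∫⁻ ω, (τ ω : ℝ≥0∞) ∂P
      = q * ∑' a : ℕ, P {ω | ((a + 1 : ℕ) : ℕ∞) ≤ τ ω} := by
        rw [hsum _ fun a => hτ (a + 1)]
        congr 1
        refine lintegral_congr fun ω => (enat_toENNReal_eq_tsum (τ ω)).trans ?_
        simp only [Set.indicator_apply, Set.mem_ofPred_eq, Pi.one_apply]
    _ = ∑' a : ℕ, q * P {ω | ((a + 1 : ℕ) : ℕ∞) ≤ τ ω} := ENNReal.tsum_mul_left.symm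
    _ ≤ ∑' a : ℕ, P {ω | ((a + 1 : ℕ) : ℕ∞) ≤ τ ω ∧ τ ω < ((a + 1 + m : ℕ) : ℕ∞)} :=
        ENNReal.tsum_le_tsum hcon
    _ ≤ ∫⁻ _, (m : ℝ≥0∞) ∂P := by
        rw [hsum _ hw]
        refine lintegral_mono fun ω => le_trans (le_of_eq ?_) (tsum_window_le (τ ω) m)
        simp only [Set.indicator_apply, Set.mem_ofPred_eq, Pi.one_apply]
    _ = m := by simp

/-- The tail-sum formula for the mean of the delay, truncated after `m` terms. -/
lemma sum_measure_le_setLIntegral_sub {Ω : Type*} [MeasurableSpace Ω] (P : Measure Ω)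
    {τ : Ω → ℕ∞} (hτ : ∀ n : ℕ, MeasurableSet {ω | (n : ℕ∞) ≤ τ ω}) (ν m : ℕ) :
    ∑ k ∈ Finset.range m, P {ω | ((ν + (k + 1) : ℕ) : ℕ∞) ≤ τ ω}
      ≤ ∫⁻ ω in {ω | (ν : ℕ∞) ≤ τ ω}, ((τ ω - (ν : ℕ∞) : ℕ∞) : ℝ≥0∞) ∂P := by
  classical
  have hterm : ∀ k, P {ω | ((ν + (k + 1) : ℕ) : ℕ∞) ≤ τ ω}
      = ∫⁻ ω, {ω | ((ν + (k + 1) : ℕ) : ℕ∞) ≤ τ ω}.indicator 1 ω ∂P := fun k =>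
    (lintegral_indicator_one (hτ _)).symm
  rw [Finset.sum_congr rfl fun k _ => hterm k,
    ← lintegral_finsetSum _ fun k _ => measurable_one.indicator (hτ _),
    ← lintegral_indicator (hτ ν)]
  refine lintegral_mono fun ω => ?_
  by_cases hω : (ν : ℕ∞) ≤ τ ω
  · rw [Set.indicator_of_mem (show ω ∈ {ω | (ν : ℕ∞) ≤ τ ω} from hω), enat_toENNReal_eq_tsum]
    refine le_trans (Finset.sum_le_sum fun k _ => ?_) (ENNReal.sum_le_tsum (Finset.range m))
    by_cases hk : ((ν + (k + 1) : ℕ) : ℕ∞) ≤ τ ω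
    · rw [if_pos]
      · exact Set.indicator_le_self' (fun _ _ => zero_le) ω
      · refine ENat.le_sub_of_add_le_left (ENat.natCast_ne_top ν) ?_
        exact_mod_cast hk
    · rw [Set.indicator_of_notMem (show ω ∉ {ω | ((ν + (k + 1) : ℕ) : ℕ∞) ≤ τ ω} from hk)]
      exact zero_le
  · refine (Finset.sum_eq_zero fun k _ => ?_).le.trans zero_le
    refine Set.indicator_of_notMem (s := {ω | ((ν + (k + 1) : ℕ) : ℕ∞) ≤ τ ω})
      (fun hk => hω (le_trans ?_ hk)) _
    exact_mod_cast (by omega : ν ≤ ν + (k + 1))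

variable {Y : Type*} [MeasurableSpace Y] {τ : (ℕ → Y) → ℕ∞}
  {μ₀ μ₁ : Measure Y} [IsProbabilityMeasure μ₀] [IsProbabilityMeasure μ₁]

/-- Non-asymptotic lower bound on the worst-case delay `w` of a stopping time with a large mean
under the law without a change. -/
lemma IsLogLikelihood.delay_bound {d : Y → ℝ≥0∞} {ℓ : Y → ℝ} {D : ℝ}
    (h : IsLogLikelihood μ₀ μ₁ d ℓ D) (hD : 0 ≤ D)
    (hτ : IsStoppingTime (Filtration.piLE (X := fun _ : ℕ => Y)) τ) {m : ℕ} (hm : 1 ≤ m) {c : ℝ}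
    (hc : 1 ≤ c)
    (hrun : (m : ℝ≥0∞) < ENNReal.ofReal c⁻¹ * ∫⁻ ω, (τ ω : ℝ≥0∞) ∂changeLaw μ₀ μ₁ ⊤)
    {w : ℝ} (hw : 0 ≤ w)
    (hdelay : ∀ ν : ℕ, 1 ≤ ν →
      ∫⁻ ω, ((τ ω - (ν : ℕ∞) : ℕ∞) : ℝ≥0∞) ∂(changeLaw μ₀ μ₁ ν)[|{ω | (ν : ℕ∞) ≤ τ ω}]
        ≤ ENNReal.ofReal w) :
    (1 - w / m) * Real.log c ≤ (w + 1) * D + 1 := by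
  have hc0 : 0 < c := one_pos.trans_le hc
  have hmeas := measurableSet_natCast_le hτ
  obtain ⟨b, rfl⟩ : ∃ b, m = b + 1 := ⟨m - 1, by omega⟩
  obtain ⟨a, ha⟩ := exists_window_lt (changeLaw μ₀ μ₁ ⊤) hmeas (b + 1) hrun
  have hwin := h.window_inequality hτ a b hc0
  set P := changeLaw μ₀ μ₁ ((a + 1 : ℕ) : ℕ∞) with hP
  set P' := changeLaw μ₀ μ₁ ⊤ with hP'
  set A := {ω | ((a + 1 : ℕ) : ℕ∞) ≤ τ ω ∧ τ ω < ((a + 1 + (b + 1) : ℕ) : ℕ∞)} with hA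
  let T : ℕ → Set (ℕ → Y) := fun k => {ω | ((a + 1 + k : ℕ) : ℕ∞) ≤ τ ω}
  have hT : ∀ k, MeasurableSet (T k) := fun k => hmeas _
  have hTanti : ∀ {i j}, i ≤ j → T j ⊆ T i := fun {i j} hij ω hω => by
    refine le_trans ?_ (show ((a + 1 + j : ℕ) : ℕ∞) ≤ τ ω from hω)
    exact_mod_cast (by omega : a + 1 + i ≤ a + 1 + j)
  -- Whether `τ ≥ a + 1` is decided at time `a`, before the change.
  have hsame : P' (T 0) = P (T 0) := by
    refine changeLaw_apply_of_lt (n := a) (ENat.natCast_lt_top _) ?_ (measurableSet_succ_le hτ a)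
    exact_mod_cast Nat.lt_succ_self a
  have hPA : P.real A = P.real (T 0) - P.real (T (b + 1)) := by
    rw [← measureReal_sdiff (hTanti (Nat.zero_le _)) (hT _)]
    congr 1
    ext ω
    simp [A, T]
  have hH : P (T 0) ≠ 0 := fun h0 => by
    have : P' {ω | ((a + 1 : ℕ) : ℕ∞) ≤ τ ω} = 0 := hsame.trans h0
    rw [this, mul_zero] at ha
    exact not_lt_zero ha
  have hHpos : 0 < P.real (T 0) := ENNReal.toReal_pos hH (measure_ne_top _ _)
  have hsameR : P'.real (T 0) = P.real (T 0) := congrArg ENNReal.toReal hsame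
  have hA' : c * P'.real A ≤ P.real (T 0) := by
    have h1 : P'.real A ≤ c⁻¹ * P'.real (T 0) := by
      have := ENNReal.toReal_mono (by finiteness) ha.le
      rwa [ENNReal.toReal_mul, ENNReal.toReal_ofReal (inv_nonneg.2 hc0.le)] at this
    calc c * P'.real A ≤ c * (c⁻¹ * P'.real (T 0)) := by gcongr
      _ = P.real (T 0) := by rw [mul_inv_cancel_left₀ hc0.ne', hsameR]
  have hB' : P'.real (T (b + 1)) ≤ P.real (T 0) :=
    hsameR ▸ measureReal_mono (hTanti (Nat.zero_le _))
  have hsum : ∑ k ∈ Finset.range (b + 1), P.real (T (k + 1)) ≤ w * P.real (T 0) := by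
    have h1 := sum_measure_le_setLIntegral_sub P hmeas (a + 1) (b + 1)
    have h2 := hdelay (a + 1) (by omega)
    rw [ProbabilityTheory.cond, lintegral_smul_measure, smul_eq_mul, ← hP] at h2
    have h3 : ∫⁻ ω in T 0, ((τ ω - ((a + 1 : ℕ) : ℕ∞) : ℕ∞) : ℝ≥0∞) ∂P
        ≤ ENNReal.ofReal w * P (T 0) := by
      rw [mul_comm]
      exact (ENNReal.inv_mul_le_iff hH (measure_ne_top _ _)).1 h2
    have h4 := ENNReal.toReal_mono (by finiteness) (h1.trans h3)
    rwa [ENNReal.toReal_sum fun k _ => measure_ne_top _ _, ENNReal.toReal_mul,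
      ENNReal.toReal_ofReal hw] at h4
  -- The observation at the change point itself is also counted, which turns `w` into `w + 1`.
  have hsum' : ∑ k ∈ Finset.range (b + 1), P.real (T k) ≤ (w + 1) * P.real (T 0) := by
    have h1 := Finset.sum_range_succ (fun k => P.real (T k)) (b + 1)
    rw [Finset.sum_range_succ'] at h1
    have h2 : 0 ≤ P.real (T (b + 1)) := measureReal_nonneg
    linarith
  -- Markov's inequality: the tail probabilities decrease, so each of the `b + 1` terms in `hsum` is
  -- at least the last one.
  have htail : (b + 1 : ℕ) * P.real (T (b + 1)) ≤ w * P.real (T 0) := by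
    refine le_trans ?_ hsum
    have := Finset.card_nsmul_le_sum (Finset.range (b + 1)) (fun k => P.real (T (k + 1)))
      (P.real (T (b + 1))) fun k hk =>
        measureReal_mono (hTanti (by have := Finset.mem_range.1 hk; omega))
    simpa using this
  have htail' : P.real (T (b + 1)) ≤ w / (b + 1 : ℕ) * P.real (T 0) := by
    rw [div_mul_eq_mul_div, le_div_iff₀ (by positivity), mul_comm]
    exact htail
  have hlog : 0 ≤ Real.log c := Real.log_nonneg hc
  have hwin' : (1 + Real.log c) * P.real A + P.real (T (b + 1))
      ≤ (∑ k ∈ Finset.range (b + 1), P.real (T k)) * D + c * P'.real A + P'.real (T (b + 1)) := hwin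
  rw [hPA] at hwin'
  have h1 := mul_le_mul_of_nonneg_right hsum' hD
  have h2 := mul_le_mul_of_nonneg_left htail' hlog
  refine le_of_mul_le_mul_right ?_ hHpos
  -- The two no-change terms contribute at most `2 * P.real (T 0)`. The constant terms on the left
  -- contribute exactly one `P.real (T 0)`, which leaves the `+ 1`.
  nlinarith

end DelayBound

/-! ### The relative error tends to zero. -/

section Asymptotics

/-- The relative error in the lower bound, as a function of `L = log γ`. -/
noncomputable def relError (D L : ℝ) : ℝ :=
  -- The cap at `0` makes the bound immediate for rules whose delay is already at least `L / D`.
  min 0 (((1 - 1 / (D * L)) * (L - Real.log 4 - 2 * Real.log L) - 1 - D) / L - 1)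

lemma tendsto_log_sub_div :
    Tendsto (fun L : ℝ => (L - Real.log 4 - 2 * Real.log L) / L) atTop (𝓝 1) := by
  have h1 : Tendsto (fun L : ℝ => Real.log 4 / L) atTop (𝓝 0) :=
    tendsto_const_nhds.div_atTop tendsto_id
  have h2 : Tendsto (fun L : ℝ => Real.log L / L) atTop (𝓝 0) :=
    Real.isLittleO_log_id_atTop.tendsto_div_nhds_zero
  have h3 := ((tendsto_const_nhds (x := (1 : ℝ))).sub h1).sub (h2.const_mul 2)
  rw [mul_zero, sub_zero, sub_zero] at h3
  refine h3.congr' ?_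
  filter_upwards [eventually_gt_atTop 0] with L hL
  field_simp

lemma tendsto_relError (D : ℝ) (hD : 0 < D) : Tendsto (relError D) atTop (𝓝 0) := by
  have h1 : Tendsto (fun L : ℝ => 1 / (D * L)) atTop (𝓝 0) :=
    tendsto_const_nhds.div_atTop (tendsto_id.const_mul_atTop hD)
  have h2 : Tendsto (fun L : ℝ => (1 + D) / L) atTop (𝓝 0) :=
    tendsto_const_nhds.div_atTop tendsto_id
  have h3 := ((((tendsto_const_nhds (x := (1 : ℝ))).sub h1).mul
    tendsto_log_sub_div).sub h2).sub_const 1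
  have h4 := (tendsto_const_nhds (x := (0 : ℝ))).min h3
  norm_num at h4
  refine h4.congr' ?_
  filter_upwards [eventually_gt_atTop 0] with L hL
  rw [relError]
  congr 1
  field_simp
  ring

end Asymptotics

/-! ### Choice of parameters and conclusion. -/

/-- Asymptotic lower bound on the worst-case delay, uniform over all rules whose run length is at
least `γ`. -/
lemma eventually_le_wadd {ι E : Type*} [Fintype ι] {𝒳 : ι → Type*} [∀ i, MeasurableSpace (𝒳 i)]
    (f₀ f₁ : ∀ i, Measure (𝒳 i)) [∀ i, IsProbabilityMeasure (f₀ i)]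
    [∀ i, IsProbabilityMeasure (f₁ i)]
    (h0 : ∑ i, InformationTheory.klDiv (f₁ i) (f₀ i) ≠ 0)
    (htop : ∑ i, InformationTheory.klDiv (f₁ i) (f₀ i) ≠ ∞) :
    ∀ᶠ γ : ℝ in atTop, ∀ ρ : Rule 𝒳 E, ENNReal.ofReal γ ≤ ρ.runLength f₀ f₁ →
      ENNReal.ofReal (Real.log γ) / (∑ i, InformationTheory.klDiv (f₁ i) (f₀ i)) *
        ENNReal.ofReal
          (1 + relError (∑ i, InformationTheory.klDiv (f₁ i) (f₀ i)).toReal (Real.log γ))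
        ≤ ρ.wadd f₀ f₁ := by
  have hfin : ∀ i, InformationTheory.klDiv (f₁ i) (f₀ i) ≠ ∞ := fun i =>
    ENNReal.sum_ne_top.1 htop i (Finset.mem_univ i)
  choose d ℓ hll using fun i => exists_isLogLikelihood (f₀ i) (f₁ i) (hfin i)
  have hL := IsLogLikelihood.pi hll
  rw [← ENNReal.toReal_sum fun i _ => hfin i] at hL
  have hDpos := ENNReal.toReal_pos h0 htop
  have hDof := ENNReal.ofReal_toReal htop
  set D := (∑ i, InformationTheory.klDiv (f₁ i) (f₀ i)).toReal
  have hev := Real.tendsto_log_atTop.eventually (tendsto_log_sub_div.eventually_const_lt one_pos)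
  filter_upwards [eventually_gt_atTop 0, hev,
    Real.tendsto_log_atTop.eventually_ge_atTop 1] with γ hγ hlog hL1 ρ hρ
  rw [← hDof]
  set L := Real.log γ with hLdef
  have hL0 : 0 < L := one_pos.trans_le hL1
  by_cases hW : ρ.wadd f₀ f₁ = ∞
  · rw [hW]; exact le_top
  rw [← ENNReal.ofReal_div_of_pos hDpos, ← ENNReal.ofReal_mul (by positivity),
    ← ENNReal.ofReal_toReal hW]
  refine ENNReal.ofReal_le_ofReal ?_
  set w := (ρ.wadd f₀ f₁).toReal with hw
  have hw0 : 0 ≤ w := ENNReal.toReal_nonneg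
  rcases le_or_gt (L / D) w with hcase | hcase
  · refine le_trans ?_ hcase
    have h1 : relError D L ≤ 0 := min_le_left _ _
    exact mul_le_of_le_one_right (by positivity) (by linarith)
  -- The window length `⌈L ^ 2⌉₊` must outgrow `w < L / D`, yet stay below `γ / c = 4 * L ^ 2`; both
  -- cost `log c` only a term of order `log L`.
  let c := γ / (4 * L ^ 2)
  have hc0 : 0 < c := by positivity
  have hlogc : Real.log c = L - Real.log 4 - 2 * Real.log L := by
    rw [Real.log_div hγ.ne' (by positivity), Real.log_mul (by norm_num) (by positivity),
      Real.log_pow]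
    push_cast
    ring
  have hlogc0 : 0 < Real.log c := by
    rw [hlogc]
    exact (div_pos_iff_of_pos_right hL0).1 hlog
  have hc1 : 1 ≤ c := ((Real.log_pos_iff hc0.le).1 hlogc0).le
  have hmL : L ^ 2 ≤ (⌈L ^ 2⌉₊ : ℝ) := Nat.le_ceil _
  have hm1 : 1 ≤ ⌈L ^ 2⌉₊ := Nat.one_le_ceil_iff.2 (by positivity)
  have hrun : ((⌈L ^ 2⌉₊ : ℕ) : ℝ≥0∞) < ENNReal.ofReal c⁻¹ *
      ∫⁻ ω, (ρ.τ ω : ℝ≥0∞) ∂changeLaw (Measure.pi f₀) (Measure.pi f₁) ⊤ := by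
    have h1 : ENNReal.ofReal c⁻¹ * ENNReal.ofReal γ ≤ ENNReal.ofReal c⁻¹ *
        ∫⁻ ω, (ρ.τ ω : ℝ≥0∞) ∂changeLaw (Measure.pi f₀) (Measure.pi f₁) ⊤ := by
      gcongr
      -- `pathLaw` is by definition `changeLaw` for the joint laws of all probes.
      exact hρ
    refine lt_of_lt_of_le ?_ h1
    rw [← ENNReal.ofReal_mul (by positivity), ← ENNReal.ofReal_natCast]
    refine (ENNReal.ofReal_lt_ofReal_iff (by positivity)).2 ?_
    have h2 : c⁻¹ * γ = 4 * L ^ 2 := by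
      simp only [c]; field_simp
    have h3 := Nat.ceil_lt_add_one (sq_nonneg L)
    rw [h2]
    nlinarith
  have hdelay : ∀ ν : ℕ, 1 ≤ ν →
      ∫⁻ ω, ((ρ.τ ω - (ν : ℕ∞) : ℕ∞) : ℝ≥0∞)
        ∂(changeLaw (Measure.pi f₀) (Measure.pi f₁) ν)[|{ω | (ν : ℕ∞) ≤ ρ.τ ω}]
        ≤ ENNReal.ofReal w := fun ν hν => by
    rw [ENNReal.ofReal_toReal hW]
    exact le_iSup₂_of_le (f := fun (ν : ℕ) (_ : 1 ≤ ν) => ∫⁻ ω, ((ρ.τ ω - (ν : ℕ∞) : ℕ∞) : ℝ≥0∞)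
      ∂(pathLaw f₀ f₁ ν)[|{ω | (ν : ℕ∞) ≤ ρ.τ ω}]) ν hν le_rfl
  have hbound := hL.delay_bound hDpos.le ρ.isStoppingTime hm1 hc1 hrun hw0 hdelay
  have hwm : w / (⌈L ^ 2⌉₊ : ℝ) ≤ 1 / (D * L) := by
    calc w / (⌈L ^ 2⌉₊ : ℝ) ≤ (L / D) / L ^ 2 := by gcongr
      _ = 1 / (D * L) := by field_simp
  have hbound' : (1 - 1 / (D * L)) * Real.log c ≤ (w + 1) * D + 1 := by
    refine le_trans ?_ hbound
    gcongr
  rw [hlogc] at hbound'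
  have hr : 1 + relError D L ≤
      ((1 - 1 / (D * L)) * (L - Real.log 4 - 2 * Real.log L) - 1 - D) / L := by
    have : relError D L ≤ _ := min_le_right _ _
    linarith
  calc L / D * (1 + relError D L)
      ≤ L / D * (((1 - 1 / (D * L)) * (L - Real.log 4 - 2 * Real.log L) - 1 - D) / L) := by gcongr
    _ = ((1 - 1 / (D * L)) * (L - Real.log 4 - 2 * Real.log L) - 1 - D) / D := by
        rw [div_mul_div_comm, mul_comm D L, mul_div_mul_left _ _ hL0.ne']
    _ ≤ w := by
        rw [div_le_iff₀ hDpos]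
        linarith

end FaultLocalization

theorem mainTheorem1 {V : Type*} [Finite V] (G : SimpleGraph V) (M : Set V)
    (Q : Finset (FaultLocalization.Probe G M))
    {𝒳 : Q → Type*} [∀ P, MeasurableSpace (𝒳 P)]
    -- the pre-change laws, and the post-change laws for each possible faulty edge
    (f₀ : ∀ P : Q, Measure (𝒳 P)) [∀ P, IsProbabilityMeasure (f₀ P)]
    (f₁ : G.edgeSet → ∀ P : Q, Measure (𝒳 P)) [∀ e P, IsProbabilityMeasure (f₁ e P)]
    -- a fault does not affect the probes that avoid it
    (hf : ∀ e (P : Q), ¬ P.1.Traverses e → f₁ e P = f₀ P)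
    -- the faulty edge, whose fault is visible to some probe
    (e : G.edgeSet)
    (he : ∃ P ∈ FaultLocalization.probesThrough Q e, f₁ e P ≠ f₀ P) :
    ∃ r : ℝ → ℝ, Tendsto r atTop (𝓝 0) ∧
      ∀ᶠ γ : ℝ in atTop,
        ENNReal.ofReal (Real.log γ) /
            (∑ P ∈ FaultLocalization.probesThrough Q e,
              InformationTheory.klDiv (f₁ e P) (f₀ P)) *
          ENNReal.ofReal (1 + r γ)
        ≤ ⨅ ρ ∈ FaultLocalization.ruleClass f₀ (f₁ e) e γ, ρ.wadd f₀ (f₁ e) := by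
  classical
  -- Probes that avoid `e` have divergence `0`, so the sum may run over all probes, as the product
  -- laws require.
  have hsum : ∑ P ∈ FaultLocalization.probesThrough Q e, InformationTheory.klDiv (f₁ e P) (f₀ P)
      = ∑ P, InformationTheory.klDiv (f₁ e P) (f₀ P) := by
    refine Finset.sum_subset (Finset.subset_univ _) fun P _ hP => ?_
    have hP' : ¬ P.1.Traverses e := by simpa [FaultLocalization.probesThrough] using hP
    rw [hf e P hP', InformationTheory.klDiv_self]
  have h0 : ∑ P, InformationTheory.klDiv (f₁ e P) (f₀ P) ≠ 0 := by
    obtain ⟨P, -, hP⟩ := he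
    intro hzero
    exact hP (InformationTheory.klDiv_eq_zero_iff.1
      (Finset.sum_eq_zero_iff.1 hzero P (Finset.mem_univ P)))
  rw [hsum]
  by_cases htop : ∑ P, InformationTheory.klDiv (f₁ e P) (f₀ P) = ∞
  -- Division by `∞` gives `0` in `ℝ≥0∞`, so the bound is trivial.
  · exact ⟨0, tendsto_const_nhds, Eventually.of_forall fun γ => by
      rw [htop, ENNReal.div_top, zero_mul]; exact zero_le⟩
  · refine ⟨fun γ => FaultLocalization.relError
        (∑ P, InformationTheory.klDiv (f₁ e P) (f₀ P)).toReal (Real.log γ),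
      (FaultLocalization.tendsto_relError _ (ENNReal.toReal_pos h0 htop)).comp
        Real.tendsto_log_atTop, ?_⟩
    filter_upwards [FaultLocalization.eventually_le_wadd (E := G.edgeSet) f₀ (f₁ e) h0 htop]
      with γ hγ
    refine le_iInf₂ ?_
    rintro ρ ⟨s, hs, rfl⟩
    exact hγ (s γ) (hs.1 γ)
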